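/- Let $\mathsf d\ge 1$ be an integer and let $r,s\in\mathbb{R}$ with $0\le r<s$ be fixed. For a finite set $\Gamma\subset\mathbb{Z}^{\mathsf d}$ define its Lebesgue constant by $$\mathcal{L}(\Gamma)=\frac{1}{(2\pi)^{\mathsf d}}\int_{[-\pi,\pi)^{\mathsf d}}\Bigl|\sum_{\gamma\in\Gamma}e^{\mathbf{i}(\gamma,t)}\Bigr|\,dt,\qquad (\gamma,t)=\sum_{i=1}^{\mathsf d}\gamma_i t_i ,$$ and for $m=(m_1,\dots,m_{\mathsf d})$ with positive integers $m_1,\dots,m_{\mathsf d}$ let $$\Xi^{(m)}_{(r,s)}=\Bigl\{\gamma\in\mathbb{Z}^{\mathsf d}\ :\ r\le \frac{\gamma_{\mathsf d}}{m_{\mathsf d}}\le\cdots\le\frac{\gamma_2}{m_2}\le\frac{\gamma_1}{m_1}\le s\Bigr\}.$$ Then there is a constant $C>0$, depending only on $\mathsf d$, $r$ and $s$, such that for all $m_1,\dots,m_{\mathsf d}\in\{1,2,3,\dots\}$ $$\mathcal{L}\bigl(\Xi^{(m)}_{(r,s)}\bigr)\le C\prod_{i=1}^{\mathsf d}\ln(m_i+1).$$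 -/

import Mathlib

/-- The partial Fourier kernel `t ↦ ∑_{γ ∈ Γ} e^{i (γ, t)}` of a finite set `Γ ⊂ ℤ^d`, where
`(γ, t) = ∑ i, γ i * t i`. -/
noncomputable def fourierKernel {d : ℕ} (Γ : Finset (Fin d → ℤ)) (t : Fin d → ℝ) : ℂ :=
  ∑ γ ∈ Γ, Complex.exp (Complex.I * ((∑ i, (γ i : ℝ) * t i : ℝ) : ℂ))

/-- The Lebesgue constant of a finite set `Γ ⊂ ℤ^d`: the normalized `L¹([-π, π)^d)`-norm of its
partial Fourier kernel. -/
noncomputable def lebesgueConstant {d : ℕ} (Γ : Finset (Fin d → ℤ)) : ℝ :=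
  1 / (2 * Real.pi) ^ d *
    ∫ t in Set.univ.pi (fun _ : Fin d => Set.Ico (-Real.pi) Real.pi), ‖fourierKernel Γ t‖

/-- The set of all `γ ∈ ℤ^d` with `r ≤ γ_d / m_d ≤ ⋯ ≤ γ_2 / m_2 ≤ γ_1 / m_1 ≤ s`. -/
def polyhedralSet {d : ℕ} (r s : ℝ) (m : Fin d → ℕ) : Set (Fin d → ℤ) :=
  {γ | (∀ i, r ≤ (γ i : ℝ) / (m i : ℝ)) ∧
    (∀ i j, i ≤ j → (γ j : ℝ) / (m j : ℝ) ≤ (γ i : ℝ) / (m i : ℝ)) ∧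
    (∀ i, (γ i : ℝ) / (m i : ℝ) ≤ s)}

theorem polyhedralSet_finite {d : ℕ} (r s : ℝ) {m : Fin d → ℕ} (hm : ∀ i, 0 < m i) :
    (polyhedralSet r s m).Finite := by
  refine (Set.Finite.pi' (fun i => Set.finite_Icc ⌈r * m i⌉ ⌊s * m i⌋)).subset ?_
  rintro γ ⟨h1, -, h2⟩ i
  have hp : (0 : ℝ) < m i := by exact_mod_cast hm i
  exact ⟨Int.ceil_le.2 ((le_div_iff₀ hp).1 (h1 i)), Int.le_floor.2 ((div_le_iff₀ hp).1 (h2 i))⟩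

/-- The same set as a `Finset`, for positive `m_1, …, m_d`. -/
noncomputable def polyhedralFinset {d : ℕ} (r s : ℝ) (m : Fin d → ℕ) (hm : ∀ i, 0 < m i) :
    Finset (Fin d → ℤ) :=
  (polyhedralSet_finite r s hm).toFinset

/-
Remove the coordinate `j` with the largest `m_j` and induct on the dimension. Over a point `γ` of
the remaining coordinates, the `j`-th coordinate runs through the integers between `m_j` times the
two neighbouring quotients, so multiplying the kernel by `e^{2πix} - 1`, with `x` the `j`-th
variable on `ℝ/ℤ`, leaves only two exponentials of the form `e^{2πi⌊m_j γ_k / m_k⌋x}`. As functions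
of `γ` these are multipliers of `L¹` for trigonometric polynomials: dropping the rounding gives a
linear phase, and the correction depends only on the fractional part of `m_j γ_k / m_k`, that is,
on `γ_k` modulo `m_k`, so expanding it in characters of `ℤ/m_k` costs a factor `O(‖x‖ log m_k)`,
with `‖x‖` the distance to the nearest integer. Since `m_k ≤ m_j`, the multiplier norm divided by
`|e^{2πix} - 1|` is at most a constant times `log (m_j + 1) + m_j / (1 + m_j ‖x‖)`, whose integral
in `x` is `O(log (m_j + 1))`: one logarithm per coordinate.
-/

open MeasureTheory Set Filter Topology UnitAddTorus

theorem fourier_apply_add (n : ℤ) (x y : UnitAddCircle) :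
    fourier n (x + y) = fourier n x * fourier n y := by
  rw [fourier_apply, smul_add, AddCircle.toCircle_add, Circle.coe_mul, fourier_apply, fourier_apply]

section TrigSum

variable {ι : Type*} [Fintype ι]

/-- The trigonometric polynomial `∑ γ ∈ Γ, c γ e^{2πi (γ, x)}` as an element of `L¹` of the unit
torus. -/
noncomputable def trigSum (Γ : Finset (ι → ℤ)) (c : (ι → ℤ) → ℂ) :
    Lp ℂ 1 (volume : Measure (UnitAddTorus ι)) :=
  ∑ γ ∈ Γ, c γ • ContinuousMap.toLp 1 volume ℂ (mFourier γ)

theorem trigSum_congr {Γ : Finset (ι → ℤ)} {c c' : (ι → ℤ) → ℂ} (h : ∀ γ ∈ Γ, c γ = c' γ) :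
    trigSum Γ c = trigSum Γ c' :=
  Finset.sum_congr rfl fun γ hγ => by rw [h γ hγ]

theorem trigSum_add (Γ : Finset (ι → ℤ)) (c c' : (ι → ℤ) → ℂ) :
    trigSum Γ (c + c') = trigSum Γ c + trigSum Γ c' := by
  simp only [trigSum, Pi.add_apply, add_smul, Finset.sum_add_distrib]

theorem trigSum_smul (Γ : Finset (ι → ℤ)) (a : ℂ) (c : (ι → ℤ) → ℂ) :
    trigSum Γ (a • c) = a • trigSum Γ c := by
  simp only [trigSum, Pi.smul_apply, smul_assoc, ← Finset.smul_sum]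

theorem tendsto_trigSum {α : Type*} {l : Filter α} {Γ : Finset (ι → ℤ)} {F : α → (ι → ℤ) → ℂ}
    {c : (ι → ℤ) → ℂ} (h : ∀ γ ∈ Γ, Tendsto (fun a => F a γ) l (𝓝 (c γ))) :
    Tendsto (fun a => trigSum Γ (F a)) l (𝓝 (trigSum Γ c)) :=
  tendsto_finsetSum Γ fun γ hγ => (h γ hγ).smul_const _

theorem norm_trigSum (Γ : Finset (ι → ℤ)) (c : (ι → ℤ) → ℂ) :
    ‖trigSum Γ c‖ = ∫ x, ‖∑ γ ∈ Γ, c γ * mFourier γ x‖ := by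
  rw [L1.norm_eq_integral_norm]
  have h : trigSum Γ c = ContinuousMap.toLp 1 volume ℂ (∑ γ ∈ Γ, c γ • mFourier γ) := by
    simp only [trigSum, map_sum, map_smul]
  refine integral_congr_ae ?_
  filter_upwards [ContinuousMap.coeFn_toLp (p := 1) (𝕜 := ℂ) (volume : Measure (UnitAddTorus ι))
    (∑ γ ∈ Γ, c γ • mFourier γ)] with x hx
  simp only [h, hx, ContinuousMap.sum_apply, ContinuousMap.smul_apply, smul_eq_mul]

theorem mFourier_apply_add (γ : ι → ℤ) (x y : UnitAddTorus ι) :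
    mFourier γ (x + y) = mFourier γ x * mFourier γ y := by
  simp only [mFourier, ContinuousMap.coe_mk, Pi.add_apply, fourier_apply_add,
    Finset.prod_mul_distrib]

theorem norm_trigSum_mul_mFourier (Γ : Finset (ι → ℤ)) (c : (ι → ℤ) → ℂ) (y : UnitAddTorus ι) :
    ‖trigSum Γ fun γ => c γ * mFourier γ y‖ = ‖trigSum Γ c‖ := by
  rw [norm_trigSum, norm_trigSum,
    ← integral_add_right_eq_self (fun x => ‖∑ γ ∈ Γ, c γ * mFourier γ x‖) y]
  simp only [mFourier_apply_add, mul_assoc, mul_comm (mFourier _ y)]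

end TrigSum

/-- `f` is a Fourier multiplier of `L¹`-norm at most `A` on trigonometric polynomials with
frequencies in `Γ`. -/
def IsMultiplier {ι : Type*} [Fintype ι] (Γ : Finset (ι → ℤ)) (f : (ι → ℤ) → ℂ) (A : ℝ) : Prop :=
  ∀ c, ‖trigSum Γ (c * f)‖ ≤ A * ‖trigSum Γ c‖

namespace IsMultiplier

variable {ι : Type*} [Fintype ι] {Γ : Finset (ι → ℤ)} {f g : (ι → ℤ) → ℂ} {A B : ℝ}

theorem mono (hf : IsMultiplier Γ f A) (hAB : A ≤ B) : IsMultiplier Γ f B := fun c =>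
  (hf c).trans (mul_le_mul_of_nonneg_right hAB (norm_nonneg _))

theorem congr (hf : IsMultiplier Γ f A) (h : ∀ γ ∈ Γ, g γ = f γ) : IsMultiplier Γ g A := fun c =>
  (congrArg norm (trigSum_congr fun γ hγ => by simp only [Pi.mul_apply, h γ hγ])).trans_le (hf c)

theorem add (hf : IsMultiplier Γ f A) (hg : IsMultiplier Γ g B) :
    IsMultiplier Γ (f + g) (A + B) := fun c => by
  rw [mul_add, trigSum_add, add_mul]
  exact (norm_add_le _ _).trans (add_le_add (hf c) (hg c))

theorem mul (hf : IsMultiplier Γ f A) (hg : IsMultiplier Γ g B) (hB : 0 ≤ B) :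
    IsMultiplier Γ (f * g) (A * B) := fun c => calc
  ‖trigSum Γ (c * (f * g))‖ = ‖trigSum Γ (c * f * g)‖ := by rw [mul_assoc]
  _ ≤ B * (A * ‖trigSum Γ c‖) := (hg _).trans (mul_le_mul_of_nonneg_left (hf c) hB)
  _ = A * B * ‖trigSum Γ c‖ := by ring

theorem smul (hf : IsMultiplier Γ f A) (a : ℂ) : IsMultiplier Γ (a • f) (‖a‖ * A) := fun c => by
  rw [mul_smul_comm, trigSum_smul, norm_smul, mul_assoc]
  exact mul_le_mul_of_nonneg_left (hf c) (norm_nonneg a)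

theorem one : IsMultiplier Γ 1 1 := fun c => by rw [mul_one, one_mul]

theorem const (a : ℂ) : IsMultiplier Γ (fun _ => a) ‖a‖ :=
  ((one.smul a).mono (mul_one _).le).congr fun γ _ => by simp

theorem pow (hf : IsMultiplier Γ f A) (hA : 0 ≤ A) (n : ℕ) : IsMultiplier Γ (f ^ n) (A ^ n) := by
  induction n with
  | zero => simpa only [pow_zero] using one
  | succ n ih => simpa only [pow_succ] using ih.mul hf hA

theorem sum {α : Type*} (s : Finset α) {F : α → (ι → ℤ) → ℂ} {A : α → ℝ}
    (hF : ∀ a ∈ s, IsMultiplier Γ (F a) (A a)) :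
    IsMultiplier Γ (∑ a ∈ s, F a) (∑ a ∈ s, A a) := by
  induction s using Finset.cons_induction with
  | empty =>
    rw [Finset.sum_empty, Finset.sum_empty]
    exact (const 0).mono norm_zero.le
  | cons a s ha ih =>
    rw [Finset.sum_cons, Finset.sum_cons]
    exact (hF a (Finset.mem_cons_self a s)).add
      (ih fun b hb => hF b (Finset.mem_cons_of_mem hb))

theorem of_tendsto {α : Type*} {l : Filter α} [l.NeBot] {F : α → (ι → ℤ) → ℂ} {A : α → ℝ}
    (hF : ∀ a, IsMultiplier Γ (F a) (A a)) (hf : ∀ γ ∈ Γ, Tendsto (fun a => F a γ) l (𝓝 (f γ)))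
    (hB : Tendsto A l (𝓝 B)) : IsMultiplier Γ f B := fun c =>
  le_of_tendsto_of_tendsto' (tendsto_trigSum fun γ hγ => (hf γ hγ).const_mul (c γ)).norm
    (hB.mul_const _) fun a => hF a c

theorem of_hasSum {α : Type*} {F : α → (ι → ℤ) → ℂ} {A : α → ℝ}
    (hF : ∀ a, IsMultiplier Γ (F a) (A a)) (hf : ∀ γ ∈ Γ, HasSum (fun a => F a γ) (f γ))
    (hB : HasSum A B) : IsMultiplier Γ f B :=
  of_tendsto (fun s : Finset α => sum s fun a _ => hF a)
    (fun γ hγ => by simpa only [HasSum, Finset.sum_apply] using hf γ hγ) hB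

theorem mFourier_apply (y : UnitAddTorus ι) : IsMultiplier Γ (fun γ => mFourier γ y) 1 := fun c =>
  (norm_trigSum_mul_mFourier Γ c y).trans_le (one_mul _).ge

theorem fourier_apply (i : ι) (a : UnitAddCircle) :
    IsMultiplier Γ (fun γ => fourier (γ i) a) 1 := by
  classical
  refine (mFourier_apply (Pi.single i a)).congr fun γ _ => ?_
  change fourier (γ i) a = ∏ j, fourier (γ j) ((Pi.single i a : UnitAddTorus ι) j)
  rw [Finset.prod_eq_single i]
  · rw [Pi.single_eq_same]
  · intro j _ hj
    rw [Pi.single_eq_of_ne hj, fourier_eval_zero]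
  · exact fun h => absurd (Finset.mem_univ i) h

end IsMultiplier

section Character

variable {ι : Type*} [Fintype ι] {Γ : Finset (ι → ℤ)}

theorem norm_fourier_apply (n : ℤ) (x : UnitAddCircle) : ‖fourier n x‖ = 1 := by
  rw [fourier_apply, Circle.norm_coe]

theorem isMultiplier_fourier_affine (k : ℤ) (j : ι) (α β : ℝ) :
    IsMultiplier Γ (fun γ => fourier k ((α * γ j + β : ℝ) : UnitAddCircle)) 1 := by
  refine ((IsMultiplier.fourier_apply j ((k * α : ℝ) : UnitAddCircle)).smul
    (fourier k (β : UnitAddCircle))).mono ?_ |>.congr fun γ _ => ?_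
  · rw [norm_fourier_apply, one_mul]
  · simp only [Pi.smul_apply, smul_eq_mul, fourier_coe_apply, ← Complex.exp_add]
    congr 1
    push_cast
    ring

theorem isMultiplier_bernoulliFun_two {j : ι} {α β : ℝ}
    (h : ∀ γ ∈ Γ, α * γ j + β ∈ Icc (0 : ℝ) 1) :
    IsMultiplier Γ (fun γ => (bernoulliFun 2 (α * γ j + β) : ℂ)) (1 / 6) := by
  have hpi : (Real.pi : ℂ) ≠ 0 := by exact_mod_cast Real.pi_ne_zero
  have hterm (k : ℕ) : IsMultiplier Γ (fun γ => (1 / (2 * Real.pi ^ 2) : ℂ) * (1 / (k : ℂ) ^ 2 *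
      (fourier k ((α * γ j + β : ℝ) : UnitAddCircle) +
        (-1) ^ 2 * fourier (-k) ((α * γ j + β : ℝ) : UnitAddCircle))))
      (1 / Real.pi ^ 2 * (1 / (k : ℝ) ^ 2)) := by
    refine ((((isMultiplier_fourier_affine k j α β).add
      ((isMultiplier_fourier_affine (-k) j α β).smul ((-1) ^ 2))).smul
        (1 / (k : ℂ) ^ 2)).smul (1 / (2 * Real.pi ^ 2))).mono (le_of_eq ?_)
    simp only [norm_div, norm_pow, norm_neg, norm_one, norm_mul, Complex.norm_ofNat,
      Complex.norm_real, Real.norm_eq_abs, abs_of_pos Real.pi_pos, Complex.norm_natCast]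
    ring
  refine IsMultiplier.of_hasSum hterm (fun γ hγ => ?_) ?_
  · convert! (hasSum_one_div_nat_pow_mul_fourier le_rfl (h γ hγ)).mul_left
      (1 / (2 * Real.pi ^ 2) : ℂ) using 1
    simp only [mul_pow, Complex.I_sq, Nat.factorial_two]
    field_simp
    norm_num
  · convert! hasSum_zeta_two.mul_left (1 / Real.pi ^ 2) using 1
    field_simp

theorem isMultiplier_linear {j : ι} {α M : ℝ} (hM : 0 ≤ M) (h : ∀ γ ∈ Γ, |α * γ j| ≤ M) :
    IsMultiplier Γ (fun γ => ((α * γ j : ℝ) : ℂ)) (4 / 3 * M) := by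
  have hscaled : ∀ γ ∈ Γ, |α / (4 * M) * γ j| ≤ 1 / 4 := fun γ hγ => by
    rw [div_mul_eq_mul_div, abs_div, abs_of_nonneg (by positivity : 0 ≤ 4 * M)]
    exact div_le_of_le_mul₀ (by positivity) (by norm_num) ((h γ hγ).trans_eq (by ring))
  have hbern (β : ℝ) (hβ : β ∈ Icc (1 / 4 : ℝ) (3 / 4)) := isMultiplier_bernoulliFun_two
    (Γ := Γ) (j := j) (α := α / (4 * M)) (β := β) fun γ hγ => by
      constructor <;> linarith [abs_le.1 (hscaled γ hγ), hβ.1, hβ.2]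
  -- `x = B₂(x + 3/4) - B₂(x + 1/4)`
  refine (((hbern (3 / 4) (by norm_num)).add ((hbern (1 / 4) (by norm_num)).smul (-1))).smul
    ((4 * M : ℝ) : ℂ)).mono ?_ |>.congr fun γ hγ => ?_
  · rw [Complex.norm_real, Real.norm_of_nonneg (by positivity), norm_neg, norm_one]
    linarith
  · have hunscale : 4 * M * (α / (4 * M) * γ j) = α * γ j := by
      rcases hM.eq_or_lt with rfl | hM'
      · simp [abs_nonpos_iff.1 (h γ hγ)]
      · field_simp
    simp only [Pi.smul_apply, Pi.add_apply, smul_eq_mul, bernoulliFun_two, ← hunscale]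
    push_cast
    ring

theorem IsMultiplier.exp_sub_one {u : (ι → ℤ) → ℂ} {A : ℝ} (hu : IsMultiplier Γ u A)
    (hA : 0 ≤ A) :
    IsMultiplier Γ (fun γ => Complex.exp (u γ) - 1) (Real.exp A - 1) := by
  refine .of_hasSum (fun n : ℕ => ((hu.pow hA (n + 1)).smul ((n + 1).factorial : ℂ)⁻¹)) ?_ ?_
  · intro γ _
    simpa [Complex.exp_eq_exp_ℂ] using (hasSum_nat_add_iff' 1).2
      (NormedSpace.exp_series_hasSum_exp' (𝕂 := ℂ) (u γ))
  · simpa [Real.exp_eq_exp_ℝ] using (hasSum_nat_add_iff' 1).2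
      (NormedSpace.exp_series_hasSum_exp' (𝕂 := ℝ) A)

theorem isMultiplier_fourier_sub_one {j : ι} {a M : ℝ} (hM : 0 ≤ M)
    (h : ∀ γ ∈ Γ, |a * γ j| ≤ M) :
    IsMultiplier Γ (fun γ => fourier (γ j) (a : UnitAddCircle) - 1) (36 * (M / (1 + M))) := by
  rcases le_total (9 * M) 1 with hsmall | hlarge
  · have hlinear : IsMultiplier Γ (fun γ => 2 * Real.pi * Complex.I * (a * γ j : ℝ)) (9 * M) := by
      refine ((isMultiplier_linear hM h).smul (2 * Real.pi * Complex.I)).mono ?_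
      have hnorm : ‖(2 * Real.pi * Complex.I : ℂ)‖ = 2 * Real.pi := by
        simp [abs_of_pos Real.pi_pos]
      rw [hnorm]
      nlinarith [Real.pi_lt_d2]
    refine ((hlinear.exp_sub_one (by positivity)).mono ?_).congr fun γ _ => ?_
    · calc Real.exp (9 * M) - 1 ≤ 2 * (9 * M) := by
            have hy : |9 * M| ≤ 1 := by rwa [abs_of_nonneg (by positivity)]
            simpa [abs_of_nonneg hM] using (le_abs_self _).trans (Real.abs_exp_sub_one_le hy)
        _ ≤ 36 * (M / (1 + M)) := by
            rw [mul_div_assoc', le_div_iff₀ (by positivity)]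
            nlinarith
    · rw [fourier_coe_apply]
      congr 2
      push_cast
      ring
  · refine (((IsMultiplier.fourier_apply j (a : UnitAddCircle)).add
      (.const (-1))).mono ?_).congr fun γ _ => sub_eq_add_neg _ _
    rw [norm_neg, norm_one, mul_div_assoc', le_div_iff₀ (by positivity)]
    linarith

end Character

section UnitCircle

theorem exists_coe_eq_and_abs_eq_norm (x : UnitAddCircle) : ∃ t : ℝ, (t : UnitAddCircle) = x ∧
    |t| = ‖x‖ ∧ |t| ≤ 1 / 2 := by
  obtain ⟨y, rfl⟩ := QuotientAddGroup.mk_surjective x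
  refine ⟨y - round y, ?_, UnitAddCircle.norm_eq.symm, abs_sub_round y⟩
  rw [AddCircle.coe_sub, sub_eq_self]
  exact (AddCircle.coe_eq_zero_iff 1).2 ⟨round y, by simp⟩

theorem norm_coe_le_abs (t : ℝ) : ‖(t : UnitAddCircle)‖ ≤ |t| := by
  rw [UnitAddCircle.norm_eq]
  simpa using round_le t 0

theorem norm_fourier_one_sub_one (t : ℝ) :
    ‖fourier 1 (t : UnitAddCircle) - 1‖ = ‖2 * Real.sin (Real.pi * t)‖ := by
  rw [fourier_coe_apply, show (2 * Real.pi * Complex.I * ((1 : ℤ) : ℂ) * t / ((1 : ℝ) : ℂ)) =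
    Complex.I * ((2 * Real.pi * t : ℝ) : ℂ) by push_cast; ring,
    Complex.norm_exp_I_mul_ofReal_sub_one]
  ring_nf

theorem fourier_eq_fourier_one (n : ℤ) (x : UnitAddCircle) : fourier n x = fourier 1 (n • x) := by
  rw [fourier_apply, fourier_apply, one_smul]

theorem norm_fourier_sub_one_le (n : ℤ) (x : UnitAddCircle) :
    ‖fourier n x - 1‖ ≤ 2 * Real.pi * (|(n : ℝ)| * ‖x‖) := by
  obtain ⟨t, rfl, ht, -⟩ := exists_coe_eq_and_abs_eq_norm x
  rw [fourier_eq_fourier_one, ← AddCircle.coe_zsmul, norm_fourier_one_sub_one, ← ht, ← abs_mul,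
    norm_mul, Real.norm_ofNat, mul_assoc]
  gcongr
  calc |Real.sin (Real.pi * (n • t))| ≤ |Real.pi * (n • t)| := Real.abs_sin_le_abs
    _ = Real.pi * |n * t| := by rw [abs_mul, abs_of_pos Real.pi_pos, zsmul_eq_mul]

theorem four_mul_norm_le_norm_fourier_one_sub_one (x : UnitAddCircle) :
    4 * ‖x‖ ≤ ‖fourier 1 x - 1‖ := by
  obtain ⟨t, rfl, ht, ht_le⟩ := exists_coe_eq_and_abs_eq_norm x
  have hsin : 2 / Real.pi * |Real.pi * t| ≤ |Real.sin (Real.pi * t)| := by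
    refine Real.mul_abs_le_abs_sin ?_
    rw [abs_mul, abs_of_pos Real.pi_pos]
    nlinarith [Real.pi_pos]
  rw [abs_mul, abs_of_pos Real.pi_pos, ← mul_assoc, div_mul_cancel₀ _ Real.pi_ne_zero] at hsin
  rw [norm_fourier_one_sub_one, ← ht, norm_mul, Real.norm_ofNat, Real.norm_eq_abs]
  linarith

end UnitCircle

section DiscreteFourier

open scoped ZMod
open ZMod (toAddCircle stdAddChar)

variable {q : ℕ} [NeZero q]

theorem stdAddChar_eq_fourier_one (k : ZMod q) : stdAddChar k = fourier 1 (toAddCircle k) := by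
  rw [fourier_one, ZMod.stdAddChar_apply]
  rfl

theorem norm_toAddCircle (k : ZMod q) :
    ‖toAddCircle k‖ = (min k.val (q - k.val) : ℕ) / (q : ℝ) := by
  rw [ZMod.toAddCircle_apply, UnitAddCircle.norm_eq, abs_sub_round_div_natCast_eq,
    Nat.mod_eq_of_lt k.val_lt]

theorem inv_le_norm_toAddCircle {k : ZMod q} (hk : k ≠ 0) : (q : ℝ)⁻¹ ≤ ‖toAddCircle k‖ := by
  have hmin : 1 ≤ min k.val (q - k.val) :=
    le_min (Nat.pos_of_ne_zero ((ZMod.val_ne_zero k).2 hk)) (Nat.sub_pos_of_lt k.val_lt)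
  rw [norm_toAddCircle, inv_eq_one_div]
  gcongr
  exact_mod_cast hmin

theorem inv_norm_toAddCircle_le (k : ZMod q) :
    ‖toAddCircle k‖⁻¹ ≤ q * ((k.val : ℝ)⁻¹ + ((-k).val : ℝ)⁻¹) := by
  rcases eq_or_ne k 0 with rfl | hk
  · simp
  have : NeZero k := ⟨hk⟩
  rw [norm_toAddCircle, inv_div, div_eq_mul_inv, ZMod.val_neg_of_ne_zero]
  gcongr
  rcases min_choice k.val (q - k.val) with h | h <;> rw [h]
  · exact le_add_of_nonneg_right (by positivity)
  · exact le_add_of_nonneg_left (by positivity)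

theorem sum_zmod_val {M : Type*} [AddCommMonoid M] (q : ℕ) [NeZero q] (f : ℕ → M) :
    ∑ k : ZMod q, f k.val = ∑ n ∈ Finset.range q, f n := by
  obtain ⟨n, rfl⟩ := Nat.exists_eq_succ_of_ne_zero (NeZero.ne q)
  exact Fin.sum_univ_eq_sum_range f (n + 1)

theorem sum_inv_val_le (q : ℕ) [NeZero q] :
    ∑ k : ZMod q, (k.val : ℝ)⁻¹ ≤ 1 + Real.log q := by
  obtain ⟨n, rfl⟩ := Nat.exists_eq_succ_of_ne_zero (NeZero.ne q)
  calc ∑ k : ZMod (n + 1), (k.val : ℝ)⁻¹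
      = ∑ k ∈ Finset.range (n + 1), (k : ℝ)⁻¹ := sum_zmod_val (n + 1) fun k => (k : ℝ)⁻¹
    _ = harmonic n := by
        rw [Finset.sum_range_succ', Nat.cast_zero, inv_zero, add_zero, harmonic]
        push_cast
        rfl
    _ ≤ harmonic (n + 1) := by
        rw [harmonic_succ]
        push_cast
        exact le_add_of_nonneg_right (by positivity)
    _ ≤ 1 + Real.log (n + 1 : ℕ) := harmonic_le_one_add_log _

theorem sum_inv_norm_toAddCircle_le (q : ℕ) [NeZero q] :
    ∑ k : ZMod q, ‖toAddCircle k‖⁻¹ ≤ 2 * q * (1 + Real.log q) :=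
  calc ∑ k : ZMod q, ‖toAddCircle k‖⁻¹
      ≤ ∑ k : ZMod q, q * ((k.val : ℝ)⁻¹ + ((-k).val : ℝ)⁻¹) :=
        Finset.sum_le_sum fun k _ => inv_norm_toAddCircle_le k
    _ = 2 * q * ∑ k : ZMod q, (k.val : ℝ)⁻¹ := by
        have hneg : ∑ k : ZMod q, ((-k).val : ℝ)⁻¹ = ∑ k : ZMod q, (k.val : ℝ)⁻¹ :=
          Equiv.sum_comp (Equiv.neg (ZMod q)) fun k => (k.val : ℝ)⁻¹
        rw [← Finset.mul_sum, Finset.sum_add_distrib, hneg]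
        ring
    _ ≤ 2 * q * (1 + Real.log q) := by gcongr; exact sum_inv_val_le q

theorem IsMultiplier.zmod {ι : Type*} [Fintype ι] {Γ : Finset (ι → ℤ)} (Φ : ZMod q → ℂ) (P : ℤ)
    (j : ι) : IsMultiplier Γ (fun γ => Φ ((P * γ j : ℤ))) ((q : ℝ)⁻¹ * ∑ k, ‖𝓕 Φ k‖) := by
  refine (((IsMultiplier.sum Finset.univ fun k _ => (IsMultiplier.fourier_apply j
    (toAddCircle ((P : ZMod q) * k))).smul (𝓕 Φ k)).smul (q : ℂ)⁻¹).mono ?_).congr fun γ _ => ?_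
  · simp only [mul_one, norm_inv, Complex.norm_natCast, le_refl]
  · conv_lhs => rw [← LinearEquiv.symm_apply_apply ZMod.dft Φ, ZMod.invDFT_apply]
    simp only [Pi.smul_apply, Finset.sum_apply, stdAddChar_eq_fourier_one,
      fourier_eq_fourier_one (γ j), ← map_zsmul, zsmul_eq_mul, smul_eq_mul]
    push_cast
    congr 1
    refine Finset.sum_congr rfl fun k _ => ?_
    rw [mul_comm]
    ring_nf

end DiscreteFourier

section FractionalPart

theorem fourier_one_pow (x : UnitAddCircle) (n : ℕ) :
    (fourier 1 x : ℂ) ^ n = fourier 1 (n • x) := by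
  rw [fourier_one, fourier_one, AddCircle.toCircle_nsmul, Circle.coe_pow]

open scoped ZMod
open ZMod (toAddCircle stdAddChar)

variable {q : ℕ} [NeZero q]

/-- The function `a ↦ e^{2πi t a / q} - 1` of the representative `0 ≤ a < q` of a residue class, by
which rounding down a rational of denominator `q` perturbs a linear phase. -/
noncomputable def twist (q : ℕ) (t : ℝ) (a : ZMod q) : ℂ :=
  fourier 1 ((t * (a.val / q) : ℝ) : UnitAddCircle) - 1

theorem norm_dft_twist_zero_le (t : ℝ) : ‖𝓕 (twist q t) 0‖ ≤ q * (2 * Real.pi * |t|) := by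
  have hterm (a : ZMod q) : ‖twist q t a‖ ≤ 2 * Real.pi * |t| := by
    have hfrac : (a.val : ℝ) / q ≤ 1 :=
      div_le_one_of_le₀ (by exact_mod_cast a.val_lt.le) (by positivity)
    refine (norm_fourier_sub_one_le 1 _).trans ?_
    rw [Int.cast_one, abs_one, one_mul]
    gcongr
    refine (norm_coe_le_abs _).trans ?_
    rw [abs_mul, abs_of_nonneg (by positivity : 0 ≤ (a.val : ℝ) / q)]
    exact mul_le_of_le_one_right (abs_nonneg t) hfrac
  rw [ZMod.dft_apply_zero]
  refine (norm_sum_le_of_le Finset.univ fun a _ => hterm a).trans_eq ?_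
  rw [Finset.sum_const, Finset.card_univ, ZMod.card, nsmul_eq_mul]

theorem dft_twist_eq_geom_sum (t : ℝ) {k : ZMod q} (hk : k ≠ 0) :
    𝓕 (twist q t) k =
      ∑ n ∈ Finset.range q, fourier 1 (((t / q : ℝ) : UnitAddCircle) - toAddCircle k) ^ n := by
  have hsum : ∑ a : ZMod q, stdAddChar (-(a * k)) = (0 : ℂ) := by
    simpa only [mul_neg, neg_eq_zero, hk, if_false, Nat.cast_zero] using
      AddChar.sum_mulShift (-k) (ZMod.isPrimitive_stdAddChar q)
  rw [← sum_zmod_val q fun n => fourier 1 (((t / q : ℝ) : UnitAddCircle) - toAddCircle k) ^ n]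
  simp only [ZMod.dft_apply, twist, smul_eq_mul, mul_sub, mul_one, Finset.sum_sub_distrib, hsum,
    sub_zero]
  refine Finset.sum_congr rfl fun a _ => ?_
  rw [fourier_one_pow, stdAddChar_eq_fourier_one, ← fourier_apply_add, smul_sub, map_neg,
    ← map_nsmul, nsmul_eq_mul, ZMod.natCast_zmod_val, ← AddCircle.coe_nsmul, neg_add_eq_sub,
    nsmul_eq_mul, mul_div_left_comm]

theorem dft_twist_mul (t : ℝ) {k : ZMod q} (hk : k ≠ 0) :
    𝓕 (twist q t) k * (fourier 1 (((t / q : ℝ) : UnitAddCircle) - toAddCircle k) - 1) =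
      fourier 1 (t : UnitAddCircle) - 1 := by
  have hq : (q : ℝ) ≠ 0 := NeZero.ne _
  rw [dft_twist_eq_geom_sum t hk, geom_sum_mul, fourier_one_pow, smul_sub, ← AddCircle.coe_nsmul,
    ← map_nsmul, nsmul_eq_mul, nsmul_eq_mul, mul_div_cancel₀ _ hq, ZMod.natCast_self, zero_mul,
    map_zero, sub_zero]

theorem norm_dft_twist_le {t : ℝ} (ht : |t| ≤ 1 / 2) {k : ZMod q} (hk : k ≠ 0) :
    ‖𝓕 (twist q t) k‖ ≤ Real.pi * |t| * ‖toAddCircle k‖⁻¹ := by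
  set z : UnitAddCircle := (t / q : ℝ) - toAddCircle k with hz
  have hinv := inv_le_norm_toAddCircle hk
  have hpos : 0 < ‖toAddCircle k‖ := (inv_pos.2 (Nat.cast_pos.2 (NeZero.pos q))).trans_le hinv
  have hz_ge : ‖toAddCircle k‖ / 2 ≤ ‖z‖ := by
    have hshift : ‖((t / q : ℝ) : UnitAddCircle)‖ ≤ ‖toAddCircle k‖ / 2 := by
      refine (norm_coe_le_abs _).trans ?_
      rw [abs_div, Nat.abs_cast, div_eq_mul_inv]
      nlinarith [inv_nonneg.2 (Nat.cast_nonneg (α := ℝ) q)]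
    have := norm_sub_norm_le (toAddCircle k) ((t / q : ℝ) : UnitAddCircle)
    rw [norm_sub_rev, ← hz] at this
    linarith
  have hmul : ‖𝓕 (twist q t) k‖ * ‖fourier 1 z - 1‖ ≤ 2 * Real.pi * |t| := by
    rw [← norm_mul, dft_twist_mul t hk]
    refine (norm_fourier_sub_one_le 1 _).trans ?_
    rw [Int.cast_one, abs_one, one_mul]
    gcongr
    exact norm_coe_le_abs t
  rw [← div_eq_mul_inv, le_div_iff₀ hpos]
  nlinarith [four_mul_norm_le_norm_fourier_one_sub_one z, norm_nonneg (𝓕 (twist q t) k)]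

theorem sum_norm_dft_twist_le {t : ℝ} (ht : |t| ≤ 1 / 2) :
    (q : ℝ)⁻¹ * ∑ k, ‖𝓕 (twist q t) k‖ ≤ 2 * Real.pi * |t| * (2 + Real.log q) := by
  have hq : (q : ℝ) ≠ 0 := NeZero.ne _
  have hsum : ∑ k, ‖𝓕 (twist q t) k‖ ≤
      q * (2 * Real.pi * |t|) + Real.pi * |t| * (2 * q * (1 + Real.log q)) := by
    rw [← Finset.add_sum_erase _ _ (Finset.mem_univ 0)]
    refine add_le_add (norm_dft_twist_zero_le t) ?_
    calc ∑ k ∈ Finset.univ.erase 0, ‖𝓕 (twist q t) k‖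
        ≤ ∑ k ∈ Finset.univ.erase 0, Real.pi * |t| * ‖toAddCircle k‖⁻¹ :=
          Finset.sum_le_sum fun k hk => norm_dft_twist_le ht (Finset.ne_of_mem_erase hk)
      _ ≤ ∑ k, Real.pi * |t| * ‖toAddCircle k‖⁻¹ :=
          Finset.sum_le_sum_of_subset_of_nonneg (Finset.erase_subset _ _) fun _ _ _ => by positivity
      _ ≤ Real.pi * |t| * (2 * q * (1 + Real.log q)) := by
          rw [← Finset.mul_sum]
          gcongr
          exact sum_inv_norm_toAddCircle_le q
  calc (q : ℝ)⁻¹ * ∑ k, ‖𝓕 (twist q t) k‖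
      ≤ (q : ℝ)⁻¹ * (q * (2 * Real.pi * |t|) + Real.pi * |t| * (2 * q * (1 + Real.log q))) := by
        gcongr
    _ = 2 * Real.pi * |t| * (2 + Real.log q) := by field_simp; ring

theorem isMultiplier_fract_sub_one {ι : Type*} [Fintype ι] {Γ : Finset (ι → ℤ)} (P : ℤ) {t : ℝ}
    (ht : |t| ≤ 1 / 2) (j : ι) :
    IsMultiplier Γ
      (fun γ => fourier 1 ((t * Int.fract (P * (γ j / q) : ℝ) : ℝ) : UnitAddCircle) - 1)
      (2 * Real.pi * |t| * (2 + Real.log q)) := by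
  refine ((IsMultiplier.zmod (twist q t) P j).mono (sum_norm_dft_twist_le ht)).congr fun γ _ => ?_
  have hfract : Int.fract (P * (γ j / q) : ℝ) = ((P * γ j : ℤ) : ZMod q).val / q := by
    rw [← mul_div_assoc, ← Int.cast_mul, Int.fract_div_intCast_eq_div_intCast_mod,
      ← ZMod.val_intCast, Int.cast_natCast]
  rw [twist, hfract]

end FractionalPart

/-- A majorant, up to a constant, of the modulus of a one-dimensional Dirichlet kernel whose
summation range is determined by rounding `p` times a rational of denominator at most `p`; the
logarithm is the price of the rounding. -/
noncomputable def dirichletWeight (p : ℝ) (x : UnitAddCircle) : ℝ :=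
  Real.log (p + 1) + p / (1 + p * ‖x‖)

section DirichletWeight

theorem log_le_dirichletWeight {p : ℝ} (hp : 0 ≤ p) (x : UnitAddCircle) :
    Real.log (p + 1) ≤ dirichletWeight p x :=
  le_add_of_nonneg_right (by positivity)

theorem log_two_le_dirichletWeight {p : ℝ} (hp : 1 ≤ p) (x : UnitAddCircle) :
    Real.log 2 ≤ dirichletWeight p x :=
  (Real.log_le_log two_pos (by linarith)).trans (log_le_dirichletWeight (by linarith) x)

theorem dirichletWeight_neg (p : ℝ) (x : UnitAddCircle) :
    dirichletWeight p (-x) = dirichletWeight p x := by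
  rw [dirichletWeight, norm_neg, dirichletWeight]

theorem continuous_dirichletWeight {p : ℝ} (hp : 0 ≤ p) : Continuous (dirichletWeight p) := by
  unfold dirichletWeight
  fun_prop (disch := intro x; positivity)

theorem intervalIntegrable_div_one_add_mul_abs {p : ℝ} (hp : 0 ≤ p) (a b : ℝ) :
    IntervalIntegrable (fun t => p / (1 + p * |t|)) volume a b :=
  Continuous.intervalIntegrable (by fun_prop (disch := intro x; positivity)) a b

theorem integral_div_one_add_mul_abs {p a : ℝ} (hp : 0 ≤ p) (ha : 0 ≤ a) :
    ∫ t in -a..a, p / (1 + p * |t|) = 2 * Real.log (1 + p * a) := by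
  have hright : ∫ t in 0..a, p / (1 + p * |t|) = Real.log (1 + p * a) := by
    have hderiv : ∀ t ∈ uIcc 0 a,
        HasDerivAt (fun t => Real.log (1 + p * t)) (p / (1 + p * |t|)) t := fun t ht => by
      rw [uIcc_of_le ha] at ht
      have hpos : 1 + p * t ≠ 0 := by
        have := mul_nonneg hp ht.1
        positivity
      simpa only [abs_of_nonneg ht.1, id_eq, mul_one] using
        (((hasDerivAt_id t).const_mul p).const_add 1).log hpos
    rw [intervalIntegral.integral_eq_sub_of_hasDerivAt hderiv
      (intervalIntegrable_div_one_add_mul_abs hp 0 a), mul_zero, add_zero, Real.log_one, sub_zero]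
  have hleft : ∫ t in -a..0, p / (1 + p * |t|) = Real.log (1 + p * a) := by
    rw [← hright, ← neg_zero, ← intervalIntegral.integral_comp_neg]
    simp only [abs_neg, neg_zero]
  rw [← intervalIntegral.integral_add_adjacent_intervals
    (intervalIntegrable_div_one_add_mul_abs hp (-a) 0)
    (intervalIntegrable_div_one_add_mul_abs hp 0 a), hleft, hright, two_mul]

theorem integral_dirichletWeight_le {p : ℝ} (hp : 0 ≤ p) :
    ∫ x, dirichletWeight p x ≤ 3 * Real.log (p + 1) := by
  have hunit : ∫ x, dirichletWeight p x = Real.log (p + 1) + 2 * Real.log (1 + p * (1 / 2)) := by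
    have hcongr : EqOn (fun t : ℝ => dirichletWeight p t)
        (fun t => Real.log (p + 1) + p / (1 + p * |t|)) (uIcc (-(1 / 2)) (1 / 2)) := fun t ht => by
      rw [uIcc_of_le (by norm_num)] at ht
      have : ‖(t : UnitAddCircle)‖ = |t| :=
        (AddCircle.norm_coe_eq_abs_iff 1 one_ne_zero).2 (by rw [abs_one]; exact abs_le.2 ht)
      simp only [dirichletWeight, this]
    rw [← UnitAddCircle.intervalIntegral_preimage (-(1 / 2)), show -(1 / 2 : ℝ) + 1 = 1 / 2 by ring,
      intervalIntegral.integral_congr hcongr, intervalIntegral.integral_add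
        intervalIntegrable_const (intervalIntegrable_div_one_add_mul_abs hp _ _),
      integral_div_one_add_mul_abs hp (by norm_num), intervalIntegral.integral_const]
    norm_num
  rw [hunit]
  have : Real.log (1 + p * (1 / 2)) ≤ Real.log (p + 1) :=
    Real.log_le_log (by positivity) (by linarith)
  linarith

end DirichletWeight

section Rounding

theorem div_one_add_mul_le_dirichletWeight {p R : ℝ} (hp : 0 ≤ p) (hR : 1 ≤ R)
    (x : UnitAddCircle) :
    p * R * ‖x‖ / (1 + p * R * ‖x‖) + R * ‖x‖ * Real.log (p + 1) ≤
      R * (‖x‖ * dirichletWeight p x) := by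
  have : p * R * ‖x‖ / (1 + p * R * ‖x‖) ≤ R * ‖x‖ * (p / (1 + p * ‖x‖)) := by
    rw [mul_div_assoc', mul_comm (R * ‖x‖), ← mul_assoc]
    gcongr
    nlinarith [mul_nonneg hp (norm_nonneg x)]
  calc _ ≤ R * ‖x‖ * (p / (1 + p * ‖x‖)) + R * ‖x‖ * Real.log (p + 1) := by gcongr
    _ = R * (‖x‖ * dirichletWeight p x) := by rw [dirichletWeight]; ring

theorem norm_fourier_sub_one_le_div {M : ℝ} {n : ℤ} {x : UnitAddCircle}
    (h : |(n : ℝ)| * ‖x‖ ≤ M) :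
    ‖fourier n x - 1‖ ≤ 36 * (M / (1 + M)) := by
  have hM : 0 ≤ M := le_trans (by positivity) h
  have hlip : ‖fourier n x - 1‖ ≤ 8 * M :=
    (norm_fourier_sub_one_le n x).trans (by nlinarith [Real.pi_lt_four, Real.pi_pos])
  have htwo : ‖fourier n x - 1‖ ≤ 2 := calc
    ‖fourier n x - 1‖ ≤ ‖fourier n x‖ + ‖(1 : ℂ)‖ := norm_sub_le _ _
    _ = 2 := by rw [norm_fourier_apply, norm_one]; norm_num
  rw [mul_div_assoc', le_div_iff₀ (by positivity)]
  rcases le_total M 1 with hM1 | hM1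
  · nlinarith [mul_le_mul_of_nonneg_left hM1 hM]
  · nlinarith [mul_le_mul_of_nonneg_right htwo (by positivity : 0 ≤ 1 + M)]

theorem norm_fourier_sub_one_le_dirichletWeight {p R : ℝ} (hp : 0 ≤ p) (hR : 1 ≤ R) {n : ℤ}
    (hn : |(n : ℝ)| ≤ p * R) (x : UnitAddCircle) :
    ‖fourier n x - 1‖ ≤ 36 * R * (‖x‖ * dirichletWeight p x) := by
  have hM : ‖fourier n x - 1‖ ≤ 36 * (p * R * ‖x‖ / (1 + p * R * ‖x‖)) :=
    norm_fourier_sub_one_le_div (by gcongr)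
  have := div_one_add_mul_le_dirichletWeight hp hR x
  have hlog : 0 ≤ R * ‖x‖ * Real.log (p + 1) := by
    have := Real.log_nonneg (by linarith : 1 ≤ p + 1)
    positivity
  linarith

variable {ι : Type*} [Fintype ι] {Γ : Finset (ι → ℤ)} {j : ι} {q : ℕ} [NeZero q] {P : ℤ} {R : ℝ}

theorem fourier_floor_eq (y t : ℝ) :
    fourier ⌊y⌋ (t : UnitAddCircle) = fourier 1 ((t * y : ℝ) : UnitAddCircle) *
      fourier 1 ((-t * Int.fract y : ℝ) : UnitAddCircle) := by
  rw [← fourier_apply_add, fourier_eq_fourier_one, ← AddCircle.coe_add, ← AddCircle.coe_zsmul,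
    zsmul_eq_mul, Int.fract]
  ring_nf

theorem two_add_log_le {q p : ℝ} (hq : 1 ≤ q) (hqp : q ≤ p) :
    2 + Real.log q ≤ 4 * Real.log (p + 1) := by
  have h2 : Real.log 2 ≤ Real.log (p + 1) := Real.log_le_log two_pos (by linarith)
  have hlog : Real.log q ≤ Real.log (p + 1) := Real.log_le_log (by linarith) (by linarith)
  linarith [Real.log_two_gt_d9]

theorem isMultiplier_fourier_floor_sub_one (hqP : (q : ℝ) ≤ |(P : ℝ)|) (hR : 1 ≤ R)
    (hΓ : ∀ γ ∈ Γ, |(γ j / q : ℝ)| ≤ R) (x : UnitAddCircle) :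
    IsMultiplier Γ (fun γ => fourier ⌊(P * (γ j / q) : ℝ)⌋ x - 1)
      (36 * R * (‖x‖ * dirichletWeight |(P : ℝ)| x)) := by
  obtain ⟨t, rfl, ht, ht_le⟩ := exists_coe_eq_and_abs_eq_norm x
  set M := |(P : ℝ)| * R * |t| with hM
  have hlinear : IsMultiplier Γ (fun γ => fourier (γ j) ((t * P / q : ℝ) : UnitAddCircle) - 1)
      (36 * (M / (1 + M))) := by
    refine isMultiplier_fourier_sub_one (by positivity) fun γ hγ => ?_
    rw [show t * P / q * γ j = P * (γ j / q) * t by ring, abs_mul, abs_mul, hM]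
    exact mul_le_mul_of_nonneg_right
      (mul_le_mul_of_nonneg_left (hΓ γ hγ) (abs_nonneg _)) (abs_nonneg t)
  have hfract := isMultiplier_fract_sub_one (Γ := Γ) (q := q) P (t := -t) (by rwa [abs_neg]) j
  refine (((hfract.mul (.fourier_apply j ((t * P / q : ℝ) : UnitAddCircle)) zero_le_one).add
    hlinear).mono ?_).congr fun γ _ => ?_
  · have hlog : 2 * Real.pi * |t| * (2 + Real.log q) ≤
        36 * (R * |t| * Real.log (|(P : ℝ)| + 1)) := by
      have hq : (1 : ℝ) ≤ q := by exact_mod_cast NeZero.one_le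
      have hlog_nonneg : 0 ≤ Real.log (|(P : ℝ)| + 1) := Real.log_nonneg (by linarith)
      calc 2 * Real.pi * |t| * (2 + Real.log q)
          ≤ 2 * 4 * |t| * (4 * Real.log (|(P : ℝ)| + 1)) := by
            gcongr
            · exact Real.pi_lt_four.le
            · exact two_add_log_le hq hqP
        _ ≤ 36 * (1 * |t| * Real.log (|(P : ℝ)| + 1)) := by
            nlinarith [mul_nonneg (abs_nonneg t) hlog_nonneg]
        _ ≤ 36 * (R * |t| * Real.log (|(P : ℝ)| + 1)) := by gcongr
    have := div_one_add_mul_le_dirichletWeight (abs_nonneg (P : ℝ)) hR t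
    rw [← ht, ← hM] at this
    rw [← ht, abs_neg]
    linarith
  · have : fourier 1 ((t * (P * (γ j / q)) : ℝ) : UnitAddCircle) =
        fourier (γ j) ((t * P / q : ℝ) : UnitAddCircle) := by
      rw [fourier_eq_fourier_one (γ j), ← AddCircle.coe_zsmul, zsmul_eq_mul]
      ring_nf
    rw [fourier_floor_eq, this, Pi.add_apply, Pi.mul_apply]
    ring

theorem isMultiplier_fourier_ceil_sub_one (hqP : (q : ℝ) ≤ |(P : ℝ)|) (hR : 1 ≤ R)
    (hΓ : ∀ γ ∈ Γ, |(γ j / q : ℝ)| ≤ R) (x : UnitAddCircle) :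
    IsMultiplier Γ (fun γ => fourier ⌈(P * (γ j / q) : ℝ)⌉ x - 1)
      (36 * R * (‖x‖ * dirichletWeight |(P : ℝ)| x)) := by
  have hfloor := isMultiplier_fourier_floor_sub_one (P := -P) (by simpa) hR hΓ (-x)
  simp only [Int.cast_neg, abs_neg, norm_neg, dirichletWeight_neg, neg_mul, Int.floor_neg] at hfloor
  refine hfloor.congr fun γ _ => ?_
  rw [fourier_eq_fourier_one, fourier_eq_fourier_one (-_), neg_smul_neg]

end Rounding

section Chain

/-- The chain condition `r ≤ y_d ≤ ⋯ ≤ y_1 ≤ s`. -/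
def IsChainIn {d : ℕ} (r s : ℝ) (y : Fin d → ℝ) : Prop :=
  Antitone y ∧ ∀ i, y i ∈ Icc r s

/-- The largest value that can be inserted at position `j` into a chain `y` bounded above by
`s`. -/
noncomputable def upperNeighbor {d : ℕ} (s : ℝ) (j : Fin (d + 1)) (y : Fin d → ℝ) : ℝ :=
  if h : j = 0 then s else y (j.pred h)

/-- The smallest value that can be inserted at position `j` into a chain `y` bounded below by
`r`. -/
noncomputable def lowerNeighbor {d : ℕ} (r : ℝ) (j : Fin (d + 1)) (y : Fin d → ℝ) : ℝ :=
  if h : j = Fin.last d then r else y (j.castPred h)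

variable {d : ℕ} {r s : ℝ} {j : Fin (d + 1)} {x : ℝ} {y : Fin d → ℝ}

theorem antitone_insertNth_iff :
    Antitone (j.insertNth x y : Fin (d + 1) → ℝ) ↔
      Antitone y ∧ (∀ i, j ≤ i.castSucc → y i ≤ x) ∧ ∀ i, i.castSucc < j → x ≤ y i := by
  have hle : ∀ i, j.succAbove i ≤ j ↔ i.castSucc < j := fun i => by
    rw [← Fin.succAbove_lt_iff_castSucc_lt, (j.succAbove_ne i).le_iff_lt]
  have hge : ∀ i, j ≤ j.succAbove i ↔ j ≤ i.castSucc := fun i => by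
    rw [← Fin.lt_succAbove_iff_le_castSucc, (j.succAbove_ne i).symm.le_iff_lt]
  simp only [Antitone, Fin.forall_iff_succAbove j, Fin.insertNth_apply_same,
    Fin.insertNth_apply_succAbove, le_refl, forall_true_left, true_and, hle, hge,
    Fin.succAbove_le_succAbove_iff, forall_and]
  tauto

theorem IsChainIn.le_upperNeighbor_iff (hy : IsChainIn r s y) :
    x ≤ upperNeighbor s j y ↔ x ≤ s ∧ ∀ i, i.castSucc < j → x ≤ y i := by
  unfold upperNeighbor
  split_ifs with h
  · subst h
    simp
  · refine ⟨fun hx => ⟨hx.trans (hy.2 _).2, fun i hi => hx.trans (hy.1 ?_)⟩, fun hx => hx.2 _ ?_⟩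
    · rwa [Fin.le_pred_iff, ← Fin.castSucc_lt_iff_succ_le]
    · rw [Fin.castSucc_lt_iff_succ_le, Fin.succ_pred]

theorem IsChainIn.lowerNeighbor_le_iff (hy : IsChainIn r s y) :
    lowerNeighbor r j y ≤ x ↔ r ≤ x ∧ ∀ i, j ≤ i.castSucc → y i ≤ x := by
  unfold lowerNeighbor
  split_ifs with h
  · subst h
    simp
  · refine ⟨fun hx => ⟨(hy.2 _).1.trans hx, fun i hi => (hy.1 ?_).trans hx⟩, fun hx => hx.2 _ ?_⟩
    · rwa [Fin.castPred_le_iff]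
    · rw [Fin.castSucc_castPred]

theorem isChainIn_insertNth :
    IsChainIn r s (j.insertNth x y : Fin (d + 1) → ℝ) ↔
      IsChainIn r s y ∧ x ∈ Icc (lowerNeighbor r j y) (upperNeighbor s j y) := by
  have hsplit : IsChainIn r s (j.insertNth x y : Fin (d + 1) → ℝ) ↔ IsChainIn r s y ∧
      (r ≤ x ∧ ∀ i, j ≤ i.castSucc → y i ≤ x) ∧ x ≤ s ∧ ∀ i, i.castSucc < j → x ≤ y i := by
    simp only [IsChainIn, antitone_insertNth_iff, Fin.forall_iff_succAbove j,
      Fin.insertNth_apply_same, Fin.insertNth_apply_succAbove, mem_Icc]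
    tauto
  rw [hsplit, mem_Icc]
  exact and_congr_right fun hy => by rw [hy.lowerNeighbor_le_iff, hy.le_upperNeighbor_iff]

theorem IsChainIn.lowerNeighbor_le_upperNeighbor (hrs : r ≤ s) (hy : IsChainIn r s y) :
    lowerNeighbor r j y ≤ upperNeighbor s j y :=
  hy.lowerNeighbor_le_iff.2 ⟨hy.le_upperNeighbor_iff.2 ⟨hrs, fun i _ => (hy.2 i).1⟩, fun i hi =>
    hy.le_upperNeighbor_iff.2 ⟨(hy.2 i).2, fun _ hk =>
      hy.1 (Fin.castSucc_le_castSucc_iff.1 (hk.le.trans hi))⟩⟩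

end Chain

section Fibres

/-- The quotients `γ_i / m_i` whose ordering defines the polyhedral sets. -/
noncomputable def ratios {d : ℕ} (m : Fin d → ℕ) (γ : Fin d → ℤ) (i : Fin d) : ℝ :=
  γ i / m i

/-- The lower end of the integer interval, possibly empty, which the `j`-th coordinate fills over
the point `γ` of the remaining coordinates of a polyhedral set. -/
noncomputable def fibreMin {d : ℕ} (r : ℝ) (m : Fin (d + 1) → ℕ) (j : Fin (d + 1))
    (γ : Fin d → ℤ) : ℤ :=
  ⌈m j * lowerNeighbor r j (ratios (j.removeNth m) γ)⌉

/-- The upper end of the integer interval, possibly empty, which the `j`-th coordinate fills over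
the point `γ` of the remaining coordinates of a polyhedral set. -/
noncomputable def fibreMax {d : ℕ} (s : ℝ) (m : Fin (d + 1) → ℕ) (j : Fin (d + 1))
    (γ : Fin d → ℤ) : ℤ :=
  ⌊m j * upperNeighbor s j (ratios (j.removeNth m) γ)⌋

theorem mem_polyhedralFinset {d : ℕ} {r s : ℝ} {m : Fin d → ℕ} {hm : ∀ i, 0 < m i}
    {γ : Fin d → ℤ} : γ ∈ polyhedralFinset r s m hm ↔ IsChainIn r s (ratios m γ) := by
  simp only [polyhedralFinset, Finite.mem_toFinset, polyhedralSet, mem_ofPred_eq, IsChainIn, ratios,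
    Antitone, mem_Icc, forall_and]
  tauto

variable {d : ℕ} {r s : ℝ} {m : Fin (d + 1) → ℕ}

theorem removeNth_pos (hm : ∀ i, 0 < m i) (j : Fin (d + 1)) (i : Fin d) : 0 < j.removeNth m i :=
  hm _

theorem ratios_insertNth (m : Fin (d + 1) → ℕ) (j : Fin (d + 1)) (n : ℤ) (γ : Fin d → ℤ) :
    ratios m (j.insertNth n γ) = j.insertNth (n / m j : ℝ) (ratios (j.removeNth m) γ) :=
  Fin.eq_insertNth_iff.2 ⟨by rw [ratios, Fin.insertNth_apply_same], funext fun i => by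
    rw [Fin.removeNth, ratios, Fin.insertNth_apply_succAbove, ratios, Fin.removeNth]⟩

theorem insertNth_mem_polyhedralFinset (hm : ∀ i, 0 < m i) (j : Fin (d + 1)) (n : ℤ)
    (γ : Fin d → ℤ) :
    j.insertNth n γ ∈ polyhedralFinset r s m hm ↔
      γ ∈ polyhedralFinset r s (j.removeNth m) (removeNth_pos hm j) ∧
        n ∈ Finset.Icc (fibreMin r m j γ) (fibreMax s m j γ) := by
  have hmj : (0 : ℝ) < m j := by exact_mod_cast hm j
  rw [mem_polyhedralFinset, ratios_insertNth, isChainIn_insertNth, mem_polyhedralFinset,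
    Finset.mem_Icc, fibreMin, fibreMax, Int.ceil_le, Int.le_floor, mem_Icc, le_div_iff₀' hmj,
    div_le_iff₀' hmj]

theorem sum_polyhedralFinset {M : Type*} [AddCommMonoid M] (hm : ∀ i, 0 < m i) (j : Fin (d + 1))
    (F : (Fin (d + 1) → ℤ) → M) :
    ∑ γ ∈ polyhedralFinset r s m hm, F γ =
      ∑ γ ∈ polyhedralFinset r s (j.removeNth m) (removeNth_pos hm j),
        ∑ n ∈ Finset.Icc (fibreMin r m j γ) (fibreMax s m j γ), F (j.insertNth n γ) := by
  rw [Finset.sum_sigma']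
  refine Finset.sum_bij' (fun γ _ => ⟨j.removeNth γ, γ j⟩) (fun z _ => j.insertNth z.2 z.1)
    (fun γ hγ => ?_) (fun z hz => ?_) (fun γ _ => ?_) (fun z _ => ?_) (fun γ _ => ?_)
  · rwa [Finset.mem_sigma, ← insertNth_mem_polyhedralFinset, Fin.insertNth_self_removeNth]
  · exact (insertNth_mem_polyhedralFinset hm j z.2 z.1).2 (Finset.mem_sigma.1 hz)
  · exact Fin.insertNth_self_removeNth j γ
  · rw [Fin.removeNth_insertNth, Fin.insertNth_apply_same]
  · rw [Fin.insertNth_self_removeNth]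

theorem fibreMin_le_fibreMax_add_one (hrs : r ≤ s) (hm : ∀ i, 0 < m i) {j : Fin (d + 1)}
    {γ : Fin d → ℤ} (hγ : γ ∈ polyhedralFinset r s (j.removeNth m) (removeNth_pos hm j)) :
    fibreMin r m j γ ≤ fibreMax s m j γ + 1 := by
  rw [fibreMin, Int.ceil_le, Int.cast_add, Int.cast_one]
  exact (mul_le_mul_of_nonneg_left
    ((mem_polyhedralFinset.1 hγ).lowerNeighbor_le_upperNeighbor hrs) (Nat.cast_nonneg _)).trans
    (Int.lt_floor_add_one _).le

theorem fourier_one_sub_one_mul_sum_Icc (x : UnitAddCircle) {a b : ℤ} (hab : a ≤ b + 1) :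
    (fourier 1 x - 1) * ∑ n ∈ Finset.Icc a b, fourier n x = fourier (b + 1) x - fourier a x := by
  obtain ⟨c, rfl⟩ : ∃ c, b = c - 1 := ⟨b + 1, by ring⟩
  rw [sub_add_cancel] at hab ⊢
  induction c, hab using Int.leInduction with
  | base => simp
  | succ c hac ih =>
    rw [add_sub_cancel_right, ← Finset.insert_Icc_sub_one_right_eq_Icc hac,
      Finset.sum_insert (by simp), mul_add, ih, fourier_add]
    ring

theorem mFourier_insertNth (j : Fin (d + 1)) (n : ℤ) (γ : Fin d → ℤ) (x : UnitAddCircle)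
    (y : UnitAddTorus (Fin d)) :
    mFourier (j.insertNth n γ) (j.insertNth x y) = fourier n x * mFourier γ y := by
  simp only [mFourier, ContinuousMap.coe_mk, Fin.prod_univ_succAbove _ j, Fin.insertNth_apply_same,
    Fin.insertNth_apply_succAbove]

theorem fourier_one_sub_one_mul_sum_mFourier (hrs : r ≤ s) (hm : ∀ i, 0 < m i) (j : Fin (d + 1))
    (x : UnitAddCircle) (y : UnitAddTorus (Fin d)) :
    (fourier 1 x - 1) * ∑ γ ∈ polyhedralFinset r s m hm, mFourier γ (j.insertNth x y) =
      ∑ γ ∈ polyhedralFinset r s (j.removeNth m) (removeNth_pos hm j),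
        (fourier (fibreMax s m j γ + 1) x - fourier (fibreMin r m j γ) x) * mFourier γ y := by
  rw [sum_polyhedralFinset hm j, Finset.mul_sum]
  refine Finset.sum_congr rfl fun γ hγ => ?_
  simp only [mFourier_insertNth, ← Finset.sum_mul]
  rw [← mul_assoc, fourier_one_sub_one_mul_sum_Icc x (fibreMin_le_fibreMax_add_one hrs hm hγ)]

end Fibres

section Endpoints

variable {d : ℕ} {r s R : ℝ} {m : Fin (d + 1) → ℕ}

theorem abs_ratios_le (hr : |r| ≤ R) (hs : |s| ≤ R) {d : ℕ} {m : Fin d → ℕ}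
    {hm : ∀ i, 0 < m i} {γ : Fin d → ℤ} (hγ : γ ∈ polyhedralFinset r s m hm) (i : Fin d) :
    |ratios m γ i| ≤ R := by
  obtain ⟨hri, his⟩ := (mem_polyhedralFinset.1 hγ).2 i
  exact abs_le.2 ⟨by linarith [neg_abs_le r], by linarith [le_abs_self s]⟩

theorem abs_floor_mul_le {p a : ℝ} (hp : 1 ≤ p) (ha : |a| + 1 ≤ R) :
    |(⌊p * a⌋ : ℝ)| ≤ p * R := by
  have := mul_le_mul_of_nonneg_left ha (zero_le_one.trans hp)
  have hpa : |p * a| = p * |a| := by rw [abs_mul, abs_of_nonneg (zero_le_one.trans hp)]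
  obtain ⟨hlow, hup⟩ := abs_le.1 hpa.le
  exact abs_le.2 ⟨by linarith [Int.sub_one_lt_floor (p * a)], by linarith [Int.floor_le (p * a)]⟩

theorem abs_ceil_mul_le {p a : ℝ} (hp : 1 ≤ p) (ha : |a| + 1 ≤ R) :
    |(⌈p * a⌉ : ℝ)| ≤ p * R := by
  have := abs_floor_mul_le (R := R) (a := -a) hp (by rwa [abs_neg])
  rwa [mul_neg, Int.floor_neg, Int.cast_neg, abs_neg] at this

theorem isMultiplier_fourier_fibreMin_sub_one (hr : |r| + 1 ≤ R) (hs : |s| + 1 ≤ R)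
    (hm : ∀ i, 0 < m i) {j : Fin (d + 1)} (hj : ∀ i, m i ≤ m j) (x : UnitAddCircle) :
    IsMultiplier (polyhedralFinset r s (j.removeNth m) (removeNth_pos hm j))
      (fun γ => fourier (fibreMin r m j γ) x - 1) (36 * R * (‖x‖ * dirichletWeight (m j) x)) := by
  have hR : 1 ≤ R := by linarith [abs_nonneg r]
  have hmj : (1 : ℝ) ≤ m j := by exact_mod_cast hm j
  unfold fibreMin lowerNeighbor
  split_ifs with h
  · exact (IsMultiplier.const _).mono (norm_fourier_sub_one_le_dirichletWeight
      (zero_le_one.trans hmj) hR (abs_ceil_mul_le hmj hr) x)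
  · have : NeZero (j.removeNth m (j.castPred h)) := ⟨(hm _).ne'⟩
    have hmax : (j.removeNth m (j.castPred h) : ℝ) ≤ |((m j : ℤ) : ℝ)| := by
      rw [Int.cast_natCast, Nat.abs_cast, Nat.cast_le]
      exact hj _
    simpa only [Int.cast_natCast, Nat.abs_cast, ratios] using
      isMultiplier_fourier_ceil_sub_one hmax hR (fun γ hγ => abs_ratios_le (by linarith)
        (by linarith) hγ (j.castPred h)) x

theorem isMultiplier_fourier_fibreMax_sub_one (hr : |r| + 1 ≤ R) (hs : |s| + 1 ≤ R)
    (hm : ∀ i, 0 < m i) {j : Fin (d + 1)} (hj : ∀ i, m i ≤ m j) (x : UnitAddCircle) :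
    IsMultiplier (polyhedralFinset r s (j.removeNth m) (removeNth_pos hm j))
      (fun γ => fourier (fibreMax s m j γ) x - 1) (36 * R * (‖x‖ * dirichletWeight (m j) x)) := by
  have hR : 1 ≤ R := by linarith [abs_nonneg r]
  have hmj : (1 : ℝ) ≤ m j := by exact_mod_cast hm j
  unfold fibreMax upperNeighbor
  split_ifs with h
  · exact (IsMultiplier.const _).mono (norm_fourier_sub_one_le_dirichletWeight
      (zero_le_one.trans hmj) hR (abs_floor_mul_le hmj hs) x)
  · have : NeZero (j.removeNth m (j.pred h)) := ⟨(hm _).ne'⟩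
    have hmax : (j.removeNth m (j.pred h) : ℝ) ≤ |((m j : ℤ) : ℝ)| := by
      rw [Int.cast_natCast, Nat.abs_cast, Nat.cast_le]
      exact hj _
    simpa only [Int.cast_natCast, Nat.abs_cast, ratios] using
      isMultiplier_fourier_floor_sub_one hmax hR (fun γ hγ => abs_ratios_le (by linarith)
        (by linarith) hγ (j.pred h)) x

theorem norm_fourier_one_sub_one_le_dirichletWeight {p : ℝ} (hp : 1 ≤ p) (hR : 1 ≤ R)
    (x : UnitAddCircle) :
    ‖(fourier 1 x : ℂ) - 1‖ ≤ 12 * R * (‖x‖ * dirichletWeight p x) := by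
  have hlog := log_two_le_dirichletWeight hp x
  have hpos : 1 / 2 ≤ dirichletWeight p x := by linarith [Real.log_two_gt_d9]
  calc ‖(fourier 1 x : ℂ) - 1‖ ≤ 2 * Real.pi * (|((1 : ℤ) : ℝ)| * ‖x‖) :=
        norm_fourier_sub_one_le 1 x
    _ = 2 * Real.pi * ‖x‖ := by norm_num
    _ ≤ 2 * 3.15 * ‖x‖ := by gcongr; exact Real.pi_lt_d2.le
    _ ≤ 12 * 1 * (‖x‖ * dirichletWeight p x) := by nlinarith [norm_nonneg x, Real.log_two_gt_d9]
    _ ≤ 12 * R * (‖x‖ * dirichletWeight p x) := by gcongr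

theorem isMultiplier_fourier_fibreMax_add_one_sub_fourier_fibreMin (hr : |r| + 1 ≤ R)
    (hs : |s| + 1 ≤ R) (hm : ∀ i, 0 < m i) {j : Fin (d + 1)} (hj : ∀ i, m i ≤ m j)
    (x : UnitAddCircle) :
    IsMultiplier (polyhedralFinset r s (j.removeNth m) (removeNth_pos hm j))
      (fun γ => fourier (fibreMax s m j γ + 1) x - fourier (fibreMin r m j γ) x)
      (84 * R * (‖x‖ * dirichletWeight (m j) x)) := by
  have hR : 1 ≤ R := by linarith [abs_nonneg r]
  have hmj : (1 : ℝ) ≤ m j := by exact_mod_cast hm j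
  have hone := norm_fourier_one_sub_one_le_dirichletWeight hmj hR x
  refine ((((isMultiplier_fourier_fibreMax_sub_one hr hs hm hj x).smul (fourier 1 x)).add
    (.const (fourier 1 x - 1))).add
      ((isMultiplier_fourier_fibreMin_sub_one hr hs hm hj x).smul (-1))).mono ?_ |>.congr
        fun γ _ => ?_
  · rw [norm_fourier_apply, norm_neg, norm_one]
    linarith
  · simp only [fourier_add, Pi.add_apply, Pi.smul_apply, smul_eq_mul]
    ring

end Endpoints

section LebesgueConstant

open scoped Pointwise

variable {d : ℕ} {r s R : ℝ} {m : Fin (d + 1) → ℕ}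

theorem norm_trigSum_one {ι : Type*} [Fintype ι] (Γ : Finset (ι → ℤ)) :
    ‖trigSum Γ 1‖ = ∫ x, ‖∑ γ ∈ Γ, mFourier γ x‖ := by
  simp only [norm_trigSum, Pi.one_apply, one_mul]

theorem ae_ne_zero : ∀ᵐ x : UnitAddCircle, x ≠ 0 := by
  have hzero : volume ({0} : Set UnitAddCircle) = 0 := by
    rw [← Metric.closedBall_zero, AddCircle.volume_closedBall]
    simp
  exact compl_mem_ae_iff.mpr hzero

theorem integral_norm_sum_mFourier_insertNth_le (hrs : r ≤ s) (hr : |r| + 1 ≤ R)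
    (hs : |s| + 1 ≤ R) (hm : ∀ i, 0 < m i) {j : Fin (d + 1)} (hj : ∀ i, m i ≤ m j)
    {x : UnitAddCircle} (hx : x ≠ 0) :
    ∫ y, ‖∑ γ ∈ polyhedralFinset r s m hm, mFourier γ (j.insertNth x y)‖ ≤
      21 * R * dirichletWeight (m j) x *
        ‖trigSum (polyhedralFinset r s (j.removeNth m) (removeNth_pos hm j)) 1‖ := by
  set Γ := polyhedralFinset r s (j.removeNth m) (removeNth_pos hm j)
  set I := ∫ y, ‖∑ γ ∈ polyhedralFinset r s m hm, mFourier γ (j.insertNth x y)‖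
  refine le_of_mul_le_mul_left ?_ (by positivity : 0 < 4 * ‖x‖)
  calc 4 * ‖x‖ * I
      ≤ ‖fourier 1 x - 1‖ * I := mul_le_mul_of_nonneg_right
        (four_mul_norm_le_norm_fourier_one_sub_one x) (integral_nonneg fun _ => norm_nonneg _)
    _ = ‖trigSum Γ (1 * fun γ =>
          fourier (fibreMax s m j γ + 1) x - fourier (fibreMin r m j γ) x)‖ := by
      simp only [I, Γ, ← integral_const_mul, ← norm_mul,
        fourier_one_sub_one_mul_sum_mFourier hrs hm, norm_trigSum, one_mul]
    _ ≤ 84 * R * (‖x‖ * dirichletWeight (m j) x) * ‖trigSum Γ 1‖ :=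
      isMultiplier_fourier_fibreMax_add_one_sub_fourier_fibreMin hr hs hm hj x 1
    _ = 4 * ‖x‖ * (21 * R * dirichletWeight (m j) x * ‖trigSum Γ 1‖) := by ring

theorem integral_eq_integral_integral_insertNth {E : Type*} [NormedAddCommGroup E]
    [NormedSpace ℝ E] (j : Fin (d + 1)) {f : UnitAddTorus (Fin (d + 1)) → E} (hf : Integrable f) :
    ∫ z, f z = ∫ x, ∫ y, f (j.insertNth x y) := by
  have he := (volume_preserving_piFinSuccAbove (fun _ => UnitAddCircle) j).symm
  rw [← he.integral_comp', Measure.volume_eq_prod, integral_prod]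
  · rfl
  · exact he.integrable_comp_of_integrable hf

theorem norm_trigSum_polyhedralFinset_succ_le (hrs : r ≤ s) (hr : |r| + 1 ≤ R)
    (hs : |s| + 1 ≤ R) (hm : ∀ i, 0 < m i) {j : Fin (d + 1)} (hj : ∀ i, m i ≤ m j) :
    ‖trigSum (polyhedralFinset r s m hm) 1‖ ≤ 63 * R * Real.log (m j + 1) *
      ‖trigSum (polyhedralFinset r s (j.removeNth m) (removeNth_pos hm j)) 1‖ := by
  have hR : 0 ≤ R := by linarith [abs_nonneg r]
  set T := ‖trigSum (polyhedralFinset r s (j.removeNth m) (removeNth_pos hm j)) 1‖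
  rw [norm_trigSum_one, integral_eq_integral_integral_insertNth j
    (Continuous.integrable_of_hasCompactSupport (by fun_prop) (.of_compactSpace _))]
  calc ∫ x, ∫ y, ‖∑ γ ∈ polyhedralFinset r s m hm, mFourier γ (j.insertNth x y)‖
      ≤ ∫ x, 21 * R * dirichletWeight (m j) x * T := by
        refine integral_mono_of_nonneg
          (.of_forall fun x => integral_nonneg fun y => norm_nonneg _) ?_ ?_
        · refine Continuous.integrable_of_hasCompactSupport ?_ (.of_compactSpace _)
          have := continuous_dirichletWeight (Nat.cast_nonneg (α := ℝ) (m j))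
          fun_prop
        · filter_upwards [ae_ne_zero] with x hx
          exact integral_norm_sum_mFourier_insertNth_le hrs hr hs hm hj hx
    _ = 21 * R * (∫ x, dirichletWeight (m j) x) * T := by
        rw [integral_mul_const, integral_const_mul]
    _ ≤ 21 * R * (3 * Real.log (m j + 1)) * T := by
        gcongr
        exact integral_dirichletWeight_le (Nat.cast_nonneg _)
    _ = 63 * R * Real.log (m j + 1) * T := by ring

theorem norm_trigSum_polyhedralFinset_le (hrs : r ≤ s) (hr : |r| + 1 ≤ R) (hs : |s| + 1 ≤ R)
    (d : ℕ) (m : Fin d → ℕ) (hm : ∀ i, 0 < m i) :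
    ‖trigSum (polyhedralFinset r s m hm) 1‖ ≤ (63 * R) ^ d * ∏ i, Real.log (m i + 1) := by
  induction d with
  | zero =>
    have hcard : ((polyhedralFinset r s m hm).card : ℝ) ≤ 1 := by
      exact_mod_cast Finset.card_le_one_of_subsingleton _
    have hvol : (volume : Measure (UnitAddTorus (Fin 0))).real univ = 1 := by
      simp [Measure.real, volume_pi]
    simpa [norm_trigSum_one, mFourier, hvol] using hcard
  | succ d ih =>
    obtain ⟨j, hj⟩ := Finite.exists_max m
    have hlog : 0 ≤ Real.log (m j + 1) := Real.log_nonneg (by simp)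
    have hR : 0 ≤ R := by linarith [abs_nonneg r]
    calc ‖trigSum (polyhedralFinset r s m hm) 1‖
        ≤ 63 * R * Real.log (m j + 1) *
          ‖trigSum (polyhedralFinset r s (j.removeNth m) (removeNth_pos hm j)) 1‖ :=
          norm_trigSum_polyhedralFinset_succ_le hrs hr hs hm hj
      _ ≤ 63 * R * Real.log (m j + 1) *
          ((63 * R) ^ d * ∏ i, Real.log (j.removeNth m i + 1)) := by
          gcongr
          exact ih _ _
      _ = (63 * R) ^ (d + 1) * ∏ i, Real.log (m i + 1) := by
          rw [Fin.prod_univ_succAbove _ j]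
          simp only [Fin.removeNth]
          ring

theorem fourierKernel_two_pi_smul (Γ : Finset (Fin d → ℤ)) (t : Fin d → ℝ) :
    fourierKernel Γ ((2 * Real.pi) • t) = ∑ γ ∈ Γ, mFourier γ fun i => (t i : UnitAddCircle) := by
  refine Finset.sum_congr rfl fun γ _ => ?_
  simp only [mFourier, ContinuousMap.coe_mk, fourier_coe_apply, ← Complex.exp_sum]
  congr 1
  push_cast [Finset.mul_sum]
  refine Finset.sum_congr rfl fun i _ => ?_
  simp only [Pi.smul_apply, smul_eq_mul]
  push_cast
  ring

theorem integral_eq_setIntegral_pi_Ioc {E : Type*} [NormedAddCommGroup E] [NormedSpace ℝ E]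
    {f : UnitAddTorus (Fin d) → E} (hf : AEStronglyMeasurable f) (a : ℝ) :
    ∫ z, f z = ∫ t in univ.pi fun _ : Fin d => Ioc a (a + 1), f fun i => t i := by
  have hmk := measurePreserving_pi (fun _ : Fin d => volume.restrict (Ioc a (a + 1)))
    (fun _ => volume) fun _ => UnitAddCircle.measurePreserving_mk a
  rw [← Measure.restrict_pi_pi, ← volume_pi, ← volume_pi] at hmk
  rw [← hmk.map_eq, integral_map hmk.aemeasurable (hmk.map_eq ▸ hf)]

theorem pi_Ico_ae_eq_smul_pi_Ioc :
    (univ.pi fun _ : Fin d => Ico (-Real.pi) Real.pi) =ᵐ[volume]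
      (2 * Real.pi) • univ.pi fun _ : Fin d => Ioc (-(1 / 2) : ℝ) (-(1 / 2) + 1) := by
  have hpi : 0 < 2 * Real.pi := by positivity
  have hsmul : (2 * Real.pi) • Ioc (-(1 / 2) : ℝ) (-(1 / 2) + 1) = Ioc (-Real.pi) Real.pi := by
    rw [LinearOrderedField.smul_Ioc hpi]
    congr 1 <;> ring
  simp only [smul_set_pi₀ hpi.ne', Pi.smul_def, hsmul]
  exact Measure.univ_pi_Ico_ae_eq_Icc.trans Measure.univ_pi_Ioc_ae_eq_Icc.symm

theorem lebesgueConstant_eq_norm_trigSum (Γ : Finset (Fin d → ℤ)) :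
    lebesgueConstant Γ = ‖trigSum Γ 1‖ := by
  have hcont : Continuous fun z : UnitAddTorus (Fin d) => ‖∑ γ ∈ Γ, mFourier γ z‖ := by fun_prop
  rw [norm_trigSum_one, integral_eq_setIntegral_pi_Ioc hcont.aestronglyMeasurable (-(1 / 2))]
  simp only [← fourierKernel_two_pi_smul]
  rw [Measure.setIntegral_comp_smul_of_pos volume (fun t => ‖fourierKernel Γ t‖) _
    (by positivity : 0 < 2 * Real.pi), lebesgueConstant,
    setIntegral_congr_set pi_Ico_ae_eq_smul_pi_Ioc, Module.finrank_fin_fun, one_div, smul_eq_mul]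

theorem theoremA1511231653_general {r s : ℝ} (hrs : r ≤ s) :
    ∃ C : ℝ, 0 < C ∧ ∀ (d : ℕ) (m : Fin d → ℕ) (hm : ∀ i, 0 < m i),
      lebesgueConstant (polyhedralFinset r s m hm) ≤
        C ^ d * ∏ i, Real.log ((m i : ℝ) + 1) := by
  refine ⟨63 * (max |r| |s| + 1), by positivity, fun d m hm => ?_⟩
  rw [lebesgueConstant_eq_norm_trigSum]
  exact norm_trigSum_polyhedralFinset_le hrs (by simp) (by simp) d m hm

end LebesgueConstant

theorem theoremA1511231653 (d : ℕ) (hd : 1 ≤ d) (r s : ℝ) (hr : 0 ≤ r) (hrs : r < s) :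
    ∃ C : ℝ, 0 < C ∧ ∀ (m : Fin d → ℕ) (hm : ∀ i, 0 < m i),
      lebesgueConstant (polyhedralFinset r s m hm) ≤ C * ∏ i, Real.log ((m i : ℝ) + 1) := by
  obtain ⟨C, hC, h⟩ := theoremA1511231653_general hrs.le
  exact ⟨C ^ d, by positivity, h d⟩
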